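/- Let $\mathcal C$ be the complex Lie algebra with generators $e_i,f_i,h_i$ ($i=1,2$) and the Chevalley–Serre relations of type $G_2$ for the Cartan matrix $A=(a_{ij})=\begin{pmatrix}2&-1\\-3&2\end{pmatrix}$: $$[e_i,f_j]=\delta_{ij}h_i,\quad [h_i,h_j]=0,\quad [h_i,e_j]=a_{ij}e_j,\quad [h_i,f_j]=-a_{ij}f_j,$$ $$(\mathrm{ad}\,e_1)^2e_2=(\mathrm{ad}\,e_2)^4e_1=(\mathrm{ad}\,f_1)^2f_2=(\mathrm{ad}\,f_2)^4f_1=0 .$$ Let $\mathfrak g\subset\mathfrak{gl}_7(\mathbb C)$ be the Lie algebra, under the commutator bracket, of all matrices $$\begin{pmatrix}A&v&\tfrac1{\sqrt2}B(\varphi^t)\\ \varphi&0&-v^t\\ \tfrac1{\sqrt2}B(v)&-\varphi^t&-A^t\end{pmatrix},\qquad A\in\mathfrak{sl}_3(\mathbb C),\ v\in\mathbb C^3,\ \varphi\in(\mathbb C^3)^*,$$ where $v^t=[v_3,v_2,v_1]$, $\varphi^t=[\varphi_3,\varphi_2,\varphi_1]^{T}$, $(A^t)_{ij}=A_{4-j,4-i}$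 and $$B(v)=\begin{pmatrix}v_2&-v_1&0\\-v_3&0&v_1\\0&v_3&-v_2\end{pmatrix}.$$ Write $i'=8-i$ and $F_{ij}=E_{ij}-E_{j'i'}$, where $E_{ij}$ are the $7\times7$ matrix units. Let $(X^a)_{a=1}^{14}$ be the following basis of $\mathfrak g$: $F_{11}-F_{22}$, $F_{22}-F_{33}$, $F_{ij}$ ($1\le i\ne j\le 3$), $F_{14}-\tfrac1{\sqrt2}F_{3'2}$, $F_{24}-\tfrac1{\sqrt2}F_{1'3}$, $F_{34}-\tfrac1{\sqrt2}F_{2'1}$, $F_{41}-\tfrac1{\sqrt2}F_{23'}$, $F_{42}-\tfrac1{\sqrt2}F_{31'}$, $F_{43}-\tfrac1{\sqrt2}F_{12'}$. Let $(X_a)$ be its dual basis for the form $\langle X,Y\rangle=\tfrac16\operatorname{tr}XY$, and put $G_{ij}=\sum_a (X^a)_{ji}\,X_a\in\mathfrak g$ for $1\le i,j\le7$. (For instance $G_{12}=3F_{12}$, $G_{24}=2F_{24}-\sqrt2F_{1'3}$, $G_{11}=2F_{11}-F_{22}-F_{33}$.) **Proposition.** The assignment $$e_1\mapsto\tfrac13G_{12},\qquad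 e_2\mapsto\tfrac1{\sqrt2}G_{24},\qquad f_1\mapsto\tfrac13G_{21},\qquad f_2\mapsto\tfrac1{\sqrt2}G_{42}$$ extends to a unique homomorphism of Lie algebras $\mathcal C\to\mathfrak g$, and this homomorphism is an isomorphism. Moreover, under this isomorphism, $$h_1\mapsto\tfrac13(G_{11}-G_{22})\qquad\text{and}\qquad h_2\mapsto G_{22}.$$ -/

import Mathlib

open Matrix

noncomputable section

namespace GTwo

attribute [local instance] LieRing.ofAssociativeRing

/-- `√2` as a complex number. -/
def rt2 : ℂ := ((Real.sqrt 2 : ℝ) : ℂ)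

theorem rt2_mul_self : rt2 * rt2 = 2 := by
  unfold rt2
  rw [← Complex.ofReal_mul, Real.mul_self_sqrt (by norm_num)]
  norm_num

theorem rt2_ne_zero : rt2 ≠ 0 := by
  intro h
  have := rt2_mul_self
  simp [h] at this

/-! ### The Chevalley presentation -/

/-- The Cartan matrix of type `G₂`, with `a₁₂ = -1` and `a₂₁ = -3`. -/
def cartan : Matrix (Fin 2) (Fin 2) ℤ :=
  !![ 2, -1;
     -3,  2]

/-- The complex Lie algebra with generators `eᵢ, hᵢ, fᵢ` (`i = 1, 2`) and the Chevalley–Serre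
relations attached to `cartan`: the quotient of the free Lie algebra by the ideal generated by
`[hᵢ, hⱼ]`, `[eᵢ, fⱼ] - δᵢⱼ hᵢ`, `[hᵢ, eⱼ] - aᵢⱼ eⱼ`, `[hᵢ, fⱼ] + aᵢⱼ fⱼ`,
`(ad eᵢ)^(1 - aᵢⱼ) eⱼ` and `(ad fᵢ)^(1 - aᵢⱼ) fⱼ` (`i ≠ j`). -/
abbrev Chevalley : Type := Matrix.ToLieAlgebra ℂ cartan

/-- The class of a generator in the Chevalley presentation. -/
def gen (x : CartanMatrix.Generators (Fin 2)) : Chevalley :=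
  LieSubmodule.Quotient.mk (N := CartanMatrix.Relations.toIdeal ℂ cartan)
    (FreeLieAlgebra.of ℂ x)

/-- The Chevalley generators `e₁, e₂` are `e 0, e 1`. -/
def e (i : Fin 2) : Chevalley := gen (.E i)

/-- The Chevalley generators `f₁, f₂` are `f 0, f 1`. -/
def f (i : Fin 2) : Chevalley := gen (.F i)

/-- The Chevalley generators `h₁, h₂` are `h 0, h 1`. -/
def h (i : Fin 2) : Chevalley := gen (.H i)

/-! ### The `7 × 7` matrix realization

Rows and columns `1, …, 7` of the matrices are numbered `0, …, 6`. -/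

/-- The `3 × 3` matrix `B(v)` of a vector `v`. -/
def B (v : Fin 3 → ℂ) : Matrix (Fin 3) (Fin 3) ℂ :=
  !![ v 1, -v 0,    0;
     -v 2,    0,  v 0;
        0,  v 2, -v 1]

/-- Antidiagonal transposition of vectors, `(v₁, v₂, v₃) ↦ (v₃, v₂, v₁)`. -/
def tv (v : Fin 3 → ℂ) : Fin 3 → ℂ := fun i => v i.rev

/-- Antidiagonal transposition of `3 × 3` matrices. -/
def tm (A : Matrix (Fin 3) (Fin 3) ℂ) : Matrix (Fin 3) (Fin 3) ℂ :=
  fun i j => A j.rev i.rev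

/-- The `7 × 7` matrix with blocks
`A, v, B(φᵗ)/√2` / `φ, 0, -vᵗ` / `B(v)/√2, -φᵗ, -Aᵗ` of sizes `3, 1, 3`. -/
def blockMatrix (v : Fin 3 → ℂ) (A : Matrix (Fin 3) (Fin 3) ℂ) (φ : Fin 3 → ℂ) :
    Matrix (Fin 7) (Fin 7) ℂ :=
  !![A 0 0, A 0 1, A 0 2, v 0, rt2⁻¹ * B (tv φ) 0 0, rt2⁻¹ * B (tv φ) 0 1, rt2⁻¹ * B (tv φ) 0 2;
     A 1 0, A 1 1, A 1 2, v 1, rt2⁻¹ * B (tv φ) 1 0, rt2⁻¹ * B (tv φ) 1 1, rt2⁻¹ * B (tv φ) 1 2;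
     A 2 0, A 2 1, A 2 2, v 2, rt2⁻¹ * B (tv φ) 2 0, rt2⁻¹ * B (tv φ) 2 1, rt2⁻¹ * B (tv φ) 2 2;
     φ 0, φ 1, φ 2, 0, -tv v 0, -tv v 1, -tv v 2;
     rt2⁻¹ * B v 0 0, rt2⁻¹ * B v 0 1, rt2⁻¹ * B v 0 2, -tv φ 0, -tm A 0 0, -tm A 0 1, -tm A 0 2;
     rt2⁻¹ * B v 1 0, rt2⁻¹ * B v 1 1, rt2⁻¹ * B v 1 2, -tv φ 1, -tm A 1 0, -tm A 1 1, -tm A 1 2;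
     rt2⁻¹ * B v 2 0, rt2⁻¹ * B v 2 1, rt2⁻¹ * B v 2 2, -tv φ 2, -tm A 2 0, -tm A 2 1, -tm A 2 2]

theorem blockMatrix_entries (v : Fin 3 → ℂ) (A : Matrix (Fin 3) (Fin 3) ℂ) (φ : Fin 3 → ℂ) :
    blockMatrix v A φ 0 0 = A 0 0 ∧ blockMatrix v A φ 0 1 = A 0 1 ∧
    blockMatrix v A φ 0 2 = A 0 2 ∧ blockMatrix v A φ 0 3 = v 0 ∧
    blockMatrix v A φ 0 4 = rt2⁻¹ * φ 1 ∧ blockMatrix v A φ 0 5 = rt2⁻¹ * (-φ 2) ∧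
    blockMatrix v A φ 0 6 = rt2⁻¹ * 0 ∧ blockMatrix v A φ 1 0 = A 1 0 ∧
    blockMatrix v A φ 1 1 = A 1 1 ∧ blockMatrix v A φ 1 2 = A 1 2 ∧
    blockMatrix v A φ 1 3 = v 1 ∧ blockMatrix v A φ 1 4 = rt2⁻¹ * (-φ 0) ∧
    blockMatrix v A φ 1 5 = rt2⁻¹ * 0 ∧ blockMatrix v A φ 1 6 = rt2⁻¹ * φ 2 ∧
    blockMatrix v A φ 2 0 = A 2 0 ∧ blockMatrix v A φ 2 1 = A 2 1 ∧
    blockMatrix v A φ 2 2 = A 2 2 ∧ blockMatrix v A φ 2 3 = v 2 ∧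
    blockMatrix v A φ 2 4 = rt2⁻¹ * 0 ∧ blockMatrix v A φ 2 5 = rt2⁻¹ * φ 0 ∧
    blockMatrix v A φ 2 6 = rt2⁻¹ * (-φ 1) ∧ blockMatrix v A φ 3 0 = φ 0 ∧
    blockMatrix v A φ 3 1 = φ 1 ∧ blockMatrix v A φ 3 2 = φ 2 ∧
    blockMatrix v A φ 3 3 = 0 ∧ blockMatrix v A φ 3 4 = -v 2 ∧
    blockMatrix v A φ 3 5 = -v 1 ∧ blockMatrix v A φ 3 6 = -v 0 ∧
    blockMatrix v A φ 4 0 = rt2⁻¹ * v 1 ∧ blockMatrix v A φ 4 1 = rt2⁻¹ * (-v 0) ∧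
    blockMatrix v A φ 4 2 = rt2⁻¹ * 0 ∧ blockMatrix v A φ 4 3 = -φ 2 ∧
    blockMatrix v A φ 4 4 = -A 2 2 ∧ blockMatrix v A φ 4 5 = -A 1 2 ∧
    blockMatrix v A φ 4 6 = -A 0 2 ∧ blockMatrix v A φ 5 0 = rt2⁻¹ * (-v 2) ∧
    blockMatrix v A φ 5 1 = rt2⁻¹ * 0 ∧ blockMatrix v A φ 5 2 = rt2⁻¹ * v 0 ∧
    blockMatrix v A φ 5 3 = -φ 1 ∧ blockMatrix v A φ 5 4 = -A 2 1 ∧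
    blockMatrix v A φ 5 5 = -A 1 1 ∧ blockMatrix v A φ 5 6 = -A 0 1 ∧
    blockMatrix v A φ 6 0 = rt2⁻¹ * 0 ∧ blockMatrix v A φ 6 1 = rt2⁻¹ * v 2 ∧
    blockMatrix v A φ 6 2 = rt2⁻¹ * (-v 1) ∧ blockMatrix v A φ 6 3 = -φ 0 ∧
    blockMatrix v A φ 6 4 = -A 2 0 ∧ blockMatrix v A φ 6 5 = -A 1 0 ∧
    blockMatrix v A φ 6 6 = -A 0 0 := by
  refine ⟨rfl, rfl, rfl, rfl, rfl, rfl, rfl, rfl, rfl, rfl, rfl, rfl, rfl, rfl, rfl, rfl, rfl, rfl, rfl, rfl, rfl, rfl, rfl, rfl, rfl,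
    rfl, rfl, rfl, rfl, rfl, rfl, rfl, rfl, rfl, rfl, rfl, rfl, rfl, rfl, rfl, rfl, rfl, rfl, rfl, rfl, rfl, rfl, rfl, rfl⟩

theorem forall_fin_seven {P : Fin 7 → Prop}
    (hP : P 0 ∧ P 1 ∧ P 2 ∧ P 3 ∧ P 4 ∧ P 5 ∧ P 6) (i : Fin 7) : P i := by
  obtain ⟨h0, h1, h2, h3, h4, h5, h6⟩ := hP
  fin_cases i <;> assumption

set_option maxHeartbeats 4000000 in
/-- The representation `π : (v, A, φ) ↦ blockMatrix v A φ` of `ℂ³ ⊕ sl₃ ⊕ (ℂ³)*` on `ℂ⁷`, as a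
linear map. -/
def rep : ((Fin 3 → ℂ) × LieAlgebra.SpecialLinear.sl (Fin 3) ℂ × (Fin 3 → ℂ)) →ₗ[ℂ]
    Matrix (Fin 7) (Fin 7) ℂ where
  toFun x := blockMatrix x.1 (x.2.1 : Matrix (Fin 3) (Fin 3) ℂ) x.2.2
  map_add' x y := by
    rw [← Matrix.ext_iff]
    refine forall_fin_seven ⟨?_, ?_, ?_, ?_, ?_, ?_, ?_⟩ <;>
    refine forall_fin_seven ⟨?_, ?_, ?_, ?_, ?_, ?_, ?_⟩ <;>
    simp only [blockMatrix_entries, Matrix.add_apply, Prod.fst_add, Prod.snd_add, Pi.add_apply,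
      AddMemClass.coe_add] <;> ring
  map_smul' c x := by
    rw [← Matrix.ext_iff]
    refine forall_fin_seven ⟨?_, ?_, ?_, ?_, ?_, ?_, ?_⟩ <;>
    refine forall_fin_seven ⟨?_, ?_, ?_, ?_, ?_, ?_, ?_⟩ <;>
    simp only [blockMatrix_entries, Matrix.smul_apply, Prod.smul_fst, Prod.smul_snd, Pi.smul_apply,
      SetLike.val_smul, smul_eq_mul, RingHom.id_apply] <;> ring

theorem blockMatrix_mem (v φ : Fin 3 → ℂ) (A : Matrix (Fin 3) (Fin 3) ℂ)
    (hA : A 0 0 + A 1 1 + A 2 2 = 0) : blockMatrix v A φ ∈ LinearMap.range rep := by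
  refine ⟨(v, ⟨A, ?_⟩, φ), rfl⟩
  change Matrix.trace A = 0
  rw [Matrix.trace_fin_three, hA]

theorem rt2_inv_mul_self : rt2⁻¹ * rt2⁻¹ = 1 / 2 := by
  rw [← mul_inv, rt2_mul_self]; norm_num

set_option maxHeartbeats 4000000 in
theorem lie_blockMatrix (v w φ ψ : Fin 3 → ℂ) (A A' : Matrix (Fin 3) (Fin 3) ℂ)
    (hA : A 0 0 + A 1 1 + A 2 2 = 0) (hA' : A' 0 0 + A' 1 1 + A' 2 2 = 0) :
    blockMatrix v A φ * blockMatrix w A' ψ - blockMatrix w A' ψ * blockMatrix v A φ ∈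
      LinearMap.range rep := by
  have hr : rt2⁻¹ ^ 2 = 1 / 2 := by rw [sq, rt2_inv_mul_self]
  have hA2 : A 2 2 = -A 0 0 - A 1 1 := by linear_combination hA
  have hA2' : A' 2 2 = -A' 0 0 - A' 1 1 := by linear_combination hA'
  set M := blockMatrix v A φ * blockMatrix w A' ψ - blockMatrix w A' ψ * blockMatrix v A φ with hM
  have key : ∀ i j, M i j =
      (∑ k, blockMatrix v A φ i k * blockMatrix w A' ψ k j) -
      ∑ k, blockMatrix w A' ψ i k * blockMatrix v A φ k j := fun i j => by
    rw [hM, Matrix.sub_apply, Matrix.mul_apply, Matrix.mul_apply]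
  clear_value M
  obtain ⟨x, hx0, hx1, hx2⟩ : ∃ x : Fin 3 → ℂ, x 0 = M 0 3 ∧ x 1 = M 1 3 ∧ x 2 = M 2 3 :=
    ⟨![M 0 3, M 1 3, M 2 3], rfl, rfl, rfl⟩
  obtain ⟨y, hy0, hy1, hy2⟩ : ∃ y : Fin 3 → ℂ, y 0 = M 3 0 ∧ y 1 = M 3 1 ∧ y 2 = M 3 2 :=
    ⟨![M 3 0, M 3 1, M 3 2], rfl, rfl, rfl⟩
  obtain ⟨C, h00, h01, h02, h10, h11, h12, h20, h21, h22⟩ : ∃ C : Matrix (Fin 3) (Fin 3) ℂ,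
      C 0 0 = M 0 0 ∧ C 0 1 = M 0 1 ∧ C 0 2 = M 0 2 ∧
      C 1 0 = M 1 0 ∧ C 1 1 = M 1 1 ∧ C 1 2 = M 1 2 ∧
      C 2 0 = M 2 0 ∧ C 2 1 = M 2 1 ∧ C 2 2 = M 2 2 :=
    ⟨!![M 0 0, M 0 1, M 0 2; M 1 0, M 1 1, M 1 2; M 2 0, M 2 1, M 2 2],
      rfl, rfl, rfl, rfl, rfl, rfl, rfl, rfl, rfl⟩
  have hMb : M = blockMatrix x C y := by
    rw [← Matrix.ext_iff]
    refine forall_fin_seven ⟨?_, ?_, ?_, ?_, ?_, ?_, ?_⟩ <;>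
    refine forall_fin_seven ⟨?_, ?_, ?_, ?_, ?_, ?_, ?_⟩ <;>
    simp only [blockMatrix_entries, hx0, hx1, hx2, hy0, hy1, hy2, h00, h01, h02, h10, h11, h12,
      h20, h21, h22] <;>
    simp only [key, Fin.sum_univ_seven, blockMatrix_entries, hA2, hA2'] <;>
    generalize rt2⁻¹ = r at hr ⊢ <;>
    ring_nf <;>
    simp only [hr] <;>
    ring
  rw [hMb]
  refine blockMatrix_mem _ _ _ ?_
  simp only [h00, h11, h22, key, Fin.sum_univ_seven, blockMatrix_entries, hA2, hA2']
  generalize rt2⁻¹ = r at hr ⊢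
  ring_nf
  simp only [hr]
  ring

/-- The matrix realization of the simple Lie algebra of type `G₂`: the image of the representation
`rep`, with the commutator of `7 × 7` matrices as bracket. -/
def g : LieSubalgebra ℂ (Matrix (Fin 7) (Fin 7) ℂ) where
  toSubmodule := LinearMap.range rep
  lie_mem' := by
    rintro _ _ ⟨⟨v, A, φ⟩, rfl⟩ ⟨⟨w, A', ψ⟩, rfl⟩
    have h1 : Matrix.trace (A : Matrix (Fin 3) (Fin 3) ℂ) = 0 := A.2
    have h2 : Matrix.trace (A' : Matrix (Fin 3) (Fin 3) ℂ) = 0 := A'.2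
    rw [Matrix.trace_fin_three] at h1 h2
    exact lie_blockMatrix v w φ ψ _ _ h1 h2

/-- `F i j = Eᵢⱼ - Eⱼ'ᵢ'`, where `Eᵢⱼ` are the matrix units and `i'` is the index opposite to `i`
(`i' = 8 - i` in the numbering `1, …, 7`). -/
def F (i j : Fin 7) : Matrix (Fin 7) (Fin 7) ℂ :=
  Matrix.single i j 1 - Matrix.single j.rev i.rev 1

/-- The basis `X¹, …, X¹⁴` of the matrix realization. -/
def basisX : Fin 14 → Matrix (Fin 7) (Fin 7) ℂ :=
  ![F 0 0 - F 1 1, F 1 1 - F 2 2,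
    F 0 1, F 0 2, F 1 0, F 1 2, F 2 0, F 2 1,
    F 0 3 - rt2⁻¹ • F (Fin.rev 2) 1,
    F 1 3 - rt2⁻¹ • F (Fin.rev 0) 2,
    F 2 3 - rt2⁻¹ • F (Fin.rev 1) 0,
    F 3 0 - rt2⁻¹ • F 1 (Fin.rev 2),
    F 3 1 - rt2⁻¹ • F 2 (Fin.rev 0),
    F 3 2 - rt2⁻¹ • F 0 (Fin.rev 1)]

/-- The basis `X₁, …, X₁₄` dual to `basisX` with respect to the form `⟨X, Y⟩ = (1/6) tr XY`. -/
def dualX : Fin 14 → Matrix (Fin 7) (Fin 7) ℂ :=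
  ![(2 : ℂ) • F 0 0 - F 1 1 - F 2 2, F 0 0 + F 1 1 - (2 : ℂ) • F 2 2,
    (3 : ℂ) • F 1 0, (3 : ℂ) • F 2 0, (3 : ℂ) • F 0 1,
    (3 : ℂ) • F 2 1, (3 : ℂ) • F 0 2, (3 : ℂ) • F 1 2,
    (2 : ℂ) • F 3 0 - rt2 • F 1 (Fin.rev 2),
    (2 : ℂ) • F 3 1 - rt2 • F 2 (Fin.rev 0),
    (2 : ℂ) • F 3 2 - rt2 • F 0 (Fin.rev 1),
    (2 : ℂ) • F 0 3 - rt2 • F (Fin.rev 2) 1,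
    (2 : ℂ) • F 1 3 - rt2 • F (Fin.rev 0) 2,
    (2 : ℂ) • F 2 3 - rt2 • F (Fin.rev 1) 0]

/-- The entries `Gᵢⱼ` of the matrix `G = ∑ₐ Xᵃ ⊗ Xₐ = ∑ᵢⱼ eⱼᵢ ⊗ Gᵢⱼ`: `Gᵢⱼ` is the sum of the `Xₐ`
with the `(j, i)` entries of the `Xᵃ` as coefficients. In the numbering `1, …, 7` the element
`Gᵢⱼ` is `G (i - 1) (j - 1)`. -/
def G (i j : Fin 7) : Matrix (Fin 7) (Fin 7) ℂ :=
  ∑ a, basisX a j i • dualX a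

end GTwo

end

noncomputable section

namespace GTwo

attribute [local instance] LieRing.ofAssociativeRing

/-! ### Elements satisfying the Chevalley–Serre relations -/

/-! The presentation is bounded above by 14 spanning elements, and their matrix images form a basis
of `g`; neither simplicity nor Serre's theorem is used. Upper bound: the positive roots are α₁, α₂,
α₁+α₂, α₁+2α₂, α₁+3α₂, 2α₁+3α₂. The Serre relations and the Jacobi identity show that the span of
the corresponding root vectors, their negatives and the coroots is stable under ad of each eᵢ and fᵢ
(`IsChevalley.lie_rootVector_mem`); it is therefore an ideal containing the generators, hence
everything (`IsChevalley.span_eq_top`). Lower bound: explicit matrices satisfy the relations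
(`isChevalley_mat`), so a homomorphism exists (`IsChevalley.exists_hom`). The image of a general
combination of the 14 elements is a block matrix whose entries determine the coefficients and
exhaust `g` (`sum_smul_chevalleyBasis_mat`), which gives injectivity and the image at once.
Uniqueness holds because the eᵢ and fᵢ generate, the coroots being hᵢ = [eᵢ, fᵢ]. -/

/-- The elements `e₁, e₂, f₁, f₂, h₁, h₂` of a complex Lie algebra satisfy the Chevalley–Serre
relations of type `G₂`. -/
structure IsChevalley {L : Type*} [LieRing L] [LieAlgebra ℂ L] (e₁ e₂ f₁ f₂ h₁ h₂ : L) : Prop where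
  e₁_f₁ : ⁅e₁, f₁⁆ = h₁
  e₁_f₂ : ⁅e₁, f₂⁆ = 0
  e₂_f₁ : ⁅e₂, f₁⁆ = 0
  e₂_f₂ : ⁅e₂, f₂⁆ = h₂
  h₁_h₂ : ⁅h₁, h₂⁆ = 0
  h₁_e₁ : ⁅h₁, e₁⁆ = (2 : ℂ) • e₁
  h₁_e₂ : ⁅h₁, e₂⁆ = (-1 : ℂ) • e₂
  h₂_e₁ : ⁅h₂, e₁⁆ = (-3 : ℂ) • e₁
  h₂_e₂ : ⁅h₂, e₂⁆ = (2 : ℂ) • e₂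
  h₁_f₁ : ⁅h₁, f₁⁆ = (-2 : ℂ) • f₁
  h₁_f₂ : ⁅h₁, f₂⁆ = (1 : ℂ) • f₂
  h₂_f₁ : ⁅h₂, f₁⁆ = (3 : ℂ) • f₁
  h₂_f₂ : ⁅h₂, f₂⁆ = (-2 : ℂ) • f₂
  serre_e₁ : ⁅e₁, ⁅e₁, e₂⁆⁆ = 0
  serre_e₂ : ⁅e₂, ⁅e₂, ⁅e₂, ⁅e₂, e₁⁆⁆⁆⁆ = 0
  serre_f₁ : ⁅f₁, ⁅f₁, f₂⁆⁆ = 0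
  serre_f₂ : ⁅f₂, ⁅f₂, ⁅f₂, ⁅f₂, f₁⁆⁆⁆⁆ = 0

/-- Root vectors for the six positive roots, as iterated brackets of the simple root vectors. -/
def rootVector {L : Type*} [LieRing L] (e₁ e₂ : L) : Fin 6 → L :=
  ![e₁, e₂, ⁅e₂, e₁⁆, ⁅e₂, ⁅e₂, e₁⁆⁆, ⁅e₂, ⁅e₂, ⁅e₂, e₁⁆⁆⁆, ⁅e₁, ⁅e₂, ⁅e₂, ⁅e₂, e₁⁆⁆⁆⁆]

section Abstract

variable {L : Type*} [LieRing L] [LieAlgebra ℂ L] {e₁ e₂ f₁ f₂ h₁ h₂ : L}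

/-- The Chevalley involution. -/
theorem IsChevalley.symm (H : IsChevalley e₁ e₂ f₁ f₂ h₁ h₂) :
    IsChevalley f₁ f₂ e₁ e₂ (-h₁) (-h₂) where
  e₁_f₁ := by rw [← lie_skew, H.e₁_f₁]
  e₁_f₂ := by rw [← lie_skew, H.e₂_f₁, neg_zero]
  e₂_f₁ := by rw [← lie_skew, H.e₁_f₂, neg_zero]
  e₂_f₂ := by rw [← lie_skew, H.e₂_f₂]
  h₁_h₂ := by rw [neg_lie, lie_neg, H.h₁_h₂, neg_zero, neg_zero]
  h₁_e₁ := by rw [neg_lie, H.h₁_f₁]; module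
  h₁_e₂ := by rw [neg_lie, H.h₁_f₂]; module
  h₂_e₁ := by rw [neg_lie, H.h₂_f₁]; module
  h₂_e₂ := by rw [neg_lie, H.h₂_f₂]; module
  h₁_f₁ := by rw [neg_lie, H.h₁_e₁]; module
  h₁_f₂ := by rw [neg_lie, H.h₁_e₂]; module
  h₂_f₁ := by rw [neg_lie, H.h₂_e₁]; module
  h₂_f₂ := by rw [neg_lie, H.h₂_e₂]; module
  serre_e₁ := H.serre_f₁
  serre_e₂ := H.serre_f₂
  serre_f₁ := H.serre_e₁
  serre_f₂ := H.serre_e₂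

/-- The adjoint actions of the Chevalley generators map the positive root vectors into any subspace
containing the positive root vectors and the coroots. -/
theorem IsChevalley.lie_rootVector_mem (H : IsChevalley e₁ e₂ f₁ f₂ h₁ h₂) {W : Submodule ℂ L}
    (hx : ∀ k, rootVector e₁ e₂ k ∈ W) (hh₁ : h₁ ∈ W) (hh₂ : h₂ ∈ W) (k : Fin 6) :
    ⁅e₁, rootVector e₁ e₂ k⁆ ∈ W ∧ ⁅e₂, rootVector e₁ e₂ k⁆ ∈ W ∧
      ⁅f₁, rootVector e₁ e₂ k⁆ ∈ W ∧ ⁅f₂, rootVector e₁ e₂ k⁆ ∈ W := by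
  obtain ⟨x₃, hx₃⟩ : ∃ x, x = ⁅e₂, e₁⁆ := ⟨_, rfl⟩
  obtain ⟨x₄, hx₄⟩ : ∃ x, x = ⁅e₂, x₃⁆ := ⟨_, rfl⟩
  obtain ⟨x₅, hx₅⟩ : ∃ x, x = ⁅e₂, x₄⁆ := ⟨_, rfl⟩
  obtain ⟨x₆, hx₆⟩ : ∃ x, x = ⁅e₁, x₅⁆ := ⟨_, rfl⟩
  have hR : rootVector e₁ e₂ = ![e₁, e₂, x₃, x₄, x₅, x₆] := by
    rw [hx₆, hx₅, hx₄, hx₃]; rfl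
  rw [hR] at hx ⊢
  have m₁ : e₁ ∈ W := hx 0
  have m₂ : e₂ ∈ W := hx 1
  have m₃ : x₃ ∈ W := hx 2
  have m₄ : x₄ ∈ W := hx 3
  have m₅ : x₅ ∈ W := hx 4
  have m₆ : x₆ ∈ W := hx 5
  have e₁e₂ : ⁅e₁, e₂⁆ = -x₃ := by rw [hx₃, lie_skew]
  have e₁x₃ : ⁅e₁, x₃⁆ = 0 := by
    have := H.serre_e₁
    rwa [e₁e₂, lie_neg, neg_eq_zero] at this
  have e₁x₄ : ⁅e₁, x₄⁆ = 0 := by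
    rw [hx₄, leibniz_lie, e₁e₂, e₁x₃, neg_lie, lie_self, neg_zero, lie_zero, add_zero]
  -- Since `e₁` kills both `x₃` and `x₄`, this form of `x₆` shows that `e₁` kills it too.
  have x₃x₄ : x₆ = -⁅x₃, x₄⁆ := by
    rw [hx₆, hx₅, leibniz_lie, e₁e₂, e₁x₄, neg_lie, lie_zero, add_zero]
  have e₁x₆ : ⁅e₁, x₆⁆ = 0 := by
    rw [x₃x₄, lie_neg, leibniz_lie, e₁x₃, e₁x₄, zero_lie, lie_zero, add_zero, neg_zero]
  have e₂x₅ : ⁅e₂, x₅⁆ = 0 := by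
    rw [hx₅, hx₄, hx₃]; exact H.serre_e₂
  -- The two expressions for `x₆` give this bracket as `-⁅x₃, x₅⁆` and as `⁅x₃, x₅⁆`, so twice it
  -- vanishes.
  have e₂x₆ : ⁅e₂, x₆⁆ = 0 := by
    have p : ⁅e₂, x₆⁆ = -⁅x₃, x₅⁆ := by
      rw [x₃x₄, lie_neg, leibniz_lie, ← hx₄, ← hx₅, lie_self, zero_add]
    have q : ⁅e₂, x₆⁆ = ⁅x₃, x₅⁆ := by
      rw [hx₆, leibniz_lie, ← hx₃, e₂x₅, lie_zero, add_zero]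
    have r : (2 : ℂ) • ⁅e₂, x₆⁆ = 0 := by
      rw [two_smul]
      nth_rewrite 1 [p]
      rw [q, neg_add_cancel]
    exact (smul_eq_zero.mp r).resolve_left two_ne_zero
  have f₁e₁ : ⁅f₁, e₁⁆ = -h₁ := H.symm.e₁_f₁
  have f₁e₂ : ⁅f₁, e₂⁆ = 0 := H.symm.e₁_f₂
  have f₂e₁ : ⁅f₂, e₁⁆ = 0 := H.symm.e₂_f₁
  have f₂e₂ : ⁅f₂, e₂⁆ = -h₂ := H.symm.e₂_f₂
  have h₁x₃ : ⁅h₁, x₃⁆ = x₃ := by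
    rw [hx₃, leibniz_lie, H.h₁_e₂, H.h₁_e₁, smul_lie, lie_smul]; module
  have h₁x₄ : ⁅h₁, x₄⁆ = 0 := by
    rw [hx₄, leibniz_lie, H.h₁_e₂, h₁x₃, smul_lie]; module
  have h₁x₅ : ⁅h₁, x₅⁆ = -x₅ := by
    rw [hx₅, leibniz_lie, H.h₁_e₂, h₁x₄, smul_lie, lie_zero]; module
  have h₂x₃ : ⁅h₂, x₃⁆ = -x₃ := by
    rw [hx₃, leibniz_lie, H.h₂_e₂, H.h₂_e₁, smul_lie, lie_smul]; module
  have h₂x₄ : ⁅h₂, x₄⁆ = x₄ := by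
    rw [hx₄, leibniz_lie, H.h₂_e₂, h₂x₃, smul_lie, lie_neg]; module
  have f₁x₃ : ⁅f₁, x₃⁆ = -e₂ := by
    rw [hx₃, leibniz_lie, f₁e₂, f₁e₁, zero_lie, zero_add, lie_neg, lie_skew, H.h₁_e₂]; module
  have f₁x₄ : ⁅f₁, x₄⁆ = 0 := by
    rw [hx₄, leibniz_lie, f₁e₂, f₁x₃, zero_lie, zero_add, lie_neg, lie_self, neg_zero]
  have f₁x₅ : ⁅f₁, x₅⁆ = 0 := by
    rw [hx₅, leibniz_lie, f₁e₂, f₁x₄, zero_lie, zero_add, lie_zero]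
  have f₁x₆ : ⁅f₁, x₆⁆ = x₅ := by
    rw [hx₆, leibniz_lie, f₁e₁, f₁x₅, lie_zero, add_zero, neg_lie, h₁x₅, neg_neg]
  -- The α₂-string through α₁ is a four-dimensional sl₂-module with lowest weight -3, whence the
  -- coefficients k(4 - k) = 3, 4, 3.
  have f₂x₃ : ⁅f₂, x₃⁆ = (3 : ℂ) • e₁ := by
    rw [hx₃, leibniz_lie, f₂e₂, f₂e₁, lie_zero, add_zero, neg_lie, H.h₂_e₁]; module
  have f₂x₄ : ⁅f₂, x₄⁆ = (4 : ℂ) • x₃ := by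
    rw [hx₄, leibniz_lie, f₂e₂, f₂x₃, neg_lie, h₂x₃, lie_smul, ← hx₃]; module
  have f₂x₅ : ⁅f₂, x₅⁆ = (3 : ℂ) • x₄ := by
    rw [hx₅, leibniz_lie, f₂e₂, f₂x₄, neg_lie, h₂x₄, lie_smul, ← hx₄]; module
  have f₂x₆ : ⁅f₂, x₆⁆ = 0 := by
    rw [hx₆, leibniz_lie, f₂e₁, f₂x₅, zero_lie, zero_add, lie_smul, e₁x₄, smul_zero]
  have z : (0 : L) ∈ W := W.zero_mem
  fin_cases k <;> dsimp
  · rw [lie_self, ← hx₃, f₁e₁, f₂e₁]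
    exact ⟨z, m₃, W.neg_mem hh₁, z⟩
  · rw [lie_self, e₁e₂, f₁e₂, f₂e₂]
    exact ⟨W.neg_mem m₃, z, z, W.neg_mem hh₂⟩
  · rw [e₁x₃, ← hx₄, f₁x₃, f₂x₃]
    exact ⟨z, m₄, W.neg_mem m₂, W.smul_mem _ m₁⟩
  · rw [e₁x₄, ← hx₅, f₁x₄, f₂x₄]
    exact ⟨z, m₅, z, W.smul_mem _ m₃⟩
  · rw [← hx₆, e₂x₅, f₁x₅, f₂x₅]
    exact ⟨m₆, z, z, W.smul_mem _ m₄⟩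
  · rw [e₁x₆, e₂x₆, f₁x₆, f₂x₆]
    exact ⟨z, z, m₅, z⟩

/-- The six positive root vectors, the six negative root vectors and the two coroots. -/
def chevalleyBasis (e₁ e₂ f₁ f₂ h₁ h₂ : L) : Fin 6 ⊕ Fin 6 ⊕ Fin 2 → L :=
  Sum.elim (rootVector e₁ e₂) (Sum.elim (rootVector f₁ f₂) ![h₁, h₂])

/-- If a Lie algebra is generated by elements satisfying the Chevalley–Serre relations, then it is
spanned by the root vectors and the coroots. -/
theorem IsChevalley.span_eq_top (H : IsChevalley e₁ e₂ f₁ f₂ h₁ h₂)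
    (hgen : ∀ K : LieSubalgebra ℂ L, e₁ ∈ K → e₂ ∈ K → f₁ ∈ K → f₂ ∈ K → K = ⊤) :
    Submodule.span ℂ (Set.range (chevalleyBasis e₁ e₂ f₁ f₂ h₁ h₂)) = ⊤ := by
  set W := Submodule.span ℂ (Set.range (chevalleyBasis e₁ e₂ f₁ f₂ h₁ h₂)) with hW
  have mem (k) : chevalleyBasis e₁ e₂ f₁ f₂ h₁ h₂ k ∈ W := Submodule.subset_span ⟨k, rfl⟩
  have hx (k) : rootVector e₁ e₂ k ∈ W := mem (.inl k)
  have hy (k) : rootVector f₁ f₂ k ∈ W := mem (.inr (.inl k))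
  have hh₁ : h₁ ∈ W := mem (.inr (.inr 0))
  have hh₂ : h₂ ∈ W := mem (.inr (.inr 1))
  have stable (z : L) (hz : ∀ k, ⁅z, chevalleyBasis e₁ e₂ f₁ f₂ h₁ h₂ k⁆ ∈ W) :
      ∀ w ∈ W, ⁅z, w⁆ ∈ W := by
    intro w hw
    have : W ≤ W.comap (LieAlgebra.ad ℂ L z : L →ₗ[ℂ] L) := by
      rw [hW, Submodule.span_le, Set.range_subset_iff]
      exact hz
    exact this hw
  -- By the Jacobi identity the stabilizer of `W` under ad is a subalgebra, so stability needs
  -- checking only for the four generators.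
  let S : LieSubalgebra ℂ L :=
    { carrier := {z | ∀ w ∈ W, ⁅z, w⁆ ∈ W}
      add_mem' := fun ha hb w hw => by rw [add_lie]; exact W.add_mem (ha w hw) (hb w hw)
      zero_mem' := fun w _ => by rw [zero_lie]; exact W.zero_mem
      smul_mem' := fun c a ha w hw => by rw [smul_lie]; exact W.smul_mem c (ha w hw)
      lie_mem' := fun ha hb w hw => by
        rw [lie_lie]; exact W.sub_mem (ha _ (hb w hw)) (hb _ (ha w hw)) }
  have px := H.lie_rootVector_mem hx hh₁ hh₂
  -- The Chevalley involution swaps the roles of eᵢ and fᵢ, so the same lemma covers the negative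
  -- root vectors.
  have py := H.symm.lie_rootVector_mem hy (W.neg_mem hh₁) (W.neg_mem hh₂)
  have hS : S = ⊤ := by
    refine hgen S (stable _ ?_) (stable _ ?_) (stable _ ?_) (stable _ ?_) <;>
    rintro (k | k | k)
    · exact (px k).1
    · exact (py k).2.2.1
    · rw [← lie_skew]
      fin_cases k
      · exact W.neg_mem (H.h₁_e₁ ▸ W.smul_mem _ (hx 0))
      · exact W.neg_mem (H.h₂_e₁ ▸ W.smul_mem _ (hx 0))
    · exact (px k).2.1
    · exact (py k).2.2.2
    · rw [← lie_skew]
      fin_cases k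
      · exact W.neg_mem (H.h₁_e₂ ▸ W.smul_mem _ (hx 1))
      · exact W.neg_mem (H.h₂_e₂ ▸ W.smul_mem _ (hx 1))
    · exact (px k).2.2.1
    · exact (py k).1
    · rw [← lie_skew]
      fin_cases k
      · exact W.neg_mem (H.h₁_f₁ ▸ W.smul_mem _ (hy 0))
      · exact W.neg_mem (H.h₂_f₁ ▸ W.smul_mem _ (hy 0))
    · exact (px k).2.2.2
    · exact (py k).2.1
    · rw [← lie_skew]
      fin_cases k
      · exact W.neg_mem (H.h₁_f₂ ▸ W.smul_mem _ (hy 1))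
      · exact W.neg_mem (H.h₂_f₂ ▸ W.smul_mem _ (hy 1))
  let K : LieSubalgebra ℂ L :=
    { W with
      lie_mem' := fun {a b} _ hb => by
        have : a ∈ S := hS ▸ LieSubalgebra.mem_top a
        exact this b hb }
  have hK : K = ⊤ := hgen K (hx 0) (hx 1) (hy 0) (hy 1)
  exact congrArg LieSubalgebra.toSubmodule hK

end Abstract

/-! ### The Chevalley presentation -/

/-- The quotient map from the free Lie algebra to the Chevalley presentation. -/
def proj : FreeLieAlgebra ℂ (CartanMatrix.Generators (Fin 2)) →ₗ⁅ℂ⁆ Chevalley where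
  toFun := LieSubmodule.Quotient.mk (N := CartanMatrix.Relations.toIdeal ℂ cartan)
  map_add' _ _ := rfl
  map_smul' _ _ := rfl
  map_lie' := rfl

theorem proj_surjective : Function.Surjective proj := Quot.mk_surjective

theorem proj_of (x : CartanMatrix.Generators (Fin 2)) : proj (FreeLieAlgebra.of ℂ x) = gen x := rfl

theorem proj_eq_zero {x : FreeLieAlgebra ℂ (CartanMatrix.Generators (Fin 2))}
    (hx : x ∈ CartanMatrix.Relations.toSet ℂ cartan) : proj x = 0 :=
  LieSubmodule.Quotient.mk_eq_zero'.mpr (LieSubmodule.subset_lieSpan hx)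

/-- The generators lift to a map from the free Lie algebra into `K`; followed by the inclusion it
agrees with `proj` on generators, so the surjection `proj` lands in `K`. -/
theorem eq_top_of_gen_mem (K : LieSubalgebra ℂ Chevalley) (hK : ∀ x, gen x ∈ K) : K = ⊤ := by
  rw [eq_top_iff]
  rintro z -
  obtain ⟨y, rfl⟩ := proj_surjective z
  let ψ : FreeLieAlgebra ℂ (CartanMatrix.Generators (Fin 2)) →ₗ⁅ℂ⁆ K :=
    FreeLieAlgebra.lift ℂ fun x => ⟨gen x, hK x⟩
  have : K.incl.comp ψ = proj := by
    ext x
    simp [ψ, proj_of]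
  rw [← this]
  exact (ψ y).2

/-! ### Universal property of the presentation -/

section Relations

variable {L : Type*} [LieRing L] [LieAlgebra ℂ L]

/-- A homomorphism from the free Lie algebra kills the relations of type `G₂` if and only if the
images of the generators satisfy the Chevalley–Serre relations. -/
theorem map_relations_eq_zero_iff
    (φ : FreeLieAlgebra ℂ (CartanMatrix.Generators (Fin 2)) →ₗ⁅ℂ⁆ L) :
    (∀ r ∈ CartanMatrix.Relations.toSet ℂ cartan, φ r = 0) ↔
      IsChevalley (φ (.of ℂ (.E 0))) (φ (.of ℂ (.E 1))) (φ (.of ℂ (.F 0))) (φ (.of ℂ (.F 1)))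
        (φ (.of ℂ (.H 0))) (φ (.of ℂ (.H 1))) := by
  have c00 : cartan 0 0 = 2 := rfl
  have c01 : cartan 0 1 = -1 := rfl
  have c10 : cartan 1 0 = -3 := rfl
  have c11 : cartan 1 1 = 2 := rfl
  -- The Serre relators apply ad of the i-th generator `(-aᵢⱼ).toNat` times to the bracket of the
  -- i-th and j-th, which makes 1 - aᵢⱼ brackets in all. For i = j the exponent truncates to 0 and
  -- the relator is the trivial bracket of a generator with itself.
  have t1 : (-2 : ℤ).toNat = 0 := rfl
  have t2 : (- -1 : ℤ).toNat = 1 := rfl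
  have t3 : (- -3 : ℤ).toNat = 3 := rfl
  have two (x : L) : (2 : ℤ) • x = (2 : ℂ) • x := by module
  have neg_one (x : L) : (-1 : ℤ) • x = (-1 : ℂ) • x := by module
  have neg_three (x : L) : (-3 : ℤ) • x = (-3 : ℂ) • x := by module
  simp only [CartanMatrix.Relations.toSet, Set.mem_union, or_imp, forall_and, Set.forall_mem_range,
    Prod.forall, Fin.forall_fin_two, CartanMatrix.Relations.HH, CartanMatrix.Relations.EF,
    CartanMatrix.Relations.HE, CartanMatrix.Relations.HF, CartanMatrix.Relations.adE,
    CartanMatrix.Relations.adF, Function.uncurry_apply_pair, Function.comp_apply, c00, c01, c10,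
    c11, t1, t2, t3, pow_succ', pow_zero, Module.End.mul_apply, Module.End.one_apply,
    LieAlgebra.ad_apply, LieHom.map_lie, if_true, zero_ne_one, one_ne_zero, if_false, map_sub,
    map_add, map_zsmul, lie_self, map_zero, two, neg_one, neg_three, sub_eq_zero]
  constructor
  · rintro ⟨⟨⟨⟨⟨⟨⟨-, -⟩, hh, -⟩, ⟨e₁f₁, e₂f₁⟩, e₁f₂, e₂f₂⟩, ⟨h₁e₁, h₂e₁⟩, h₁e₂, h₂e₂⟩,
      ⟨h₁f₁, h₂f₁⟩, h₁f₂, h₂f₂⟩, ⟨-, se₂⟩, se₁, -⟩, ⟨-, sf₂⟩, sf₁, -⟩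
    exact ⟨e₁f₁, e₁f₂, e₂f₁, e₂f₂, hh, h₁e₁, h₁e₂, h₂e₁, h₂e₂,
      by rw [eq_neg_of_add_eq_zero_left h₁f₁]; module,
      by rw [eq_neg_of_add_eq_zero_left h₁f₂]; module,
      by rw [eq_neg_of_add_eq_zero_left h₂f₁]; module,
      by rw [eq_neg_of_add_eq_zero_left h₂f₂]; module, se₁, se₂, sf₁, sf₂⟩
  · intro H
    refine ⟨⟨⟨⟨⟨⟨⟨trivial, ?_⟩, H.h₁_h₂, trivial⟩, ⟨H.e₁_f₁, H.e₂_f₁⟩, H.e₁_f₂, H.e₂_f₂⟩,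
      ⟨H.h₁_e₁, H.h₂_e₁⟩, H.h₁_e₂, H.h₂_e₂⟩, ⟨?_, ?_⟩, ?_, ?_⟩, ⟨trivial, H.serre_e₂⟩,
      H.serre_e₁, trivial⟩, ⟨trivial, H.serre_f₂⟩, H.serre_f₁, trivial⟩
    · rw [← lie_skew, H.h₁_h₂, neg_zero]
    · rw [H.h₁_f₁]; module
    · rw [H.h₂_f₁]; module
    · rw [H.h₁_f₂]; module
    · rw [H.h₂_f₂]; module

theorem isChevalley_gen : IsChevalley (e 0) (e 1) (f 0) (f 1) (h 0) (h 1) :=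
  (map_relations_eq_zero_iff proj).mp fun _ => proj_eq_zero

/-- Elements satisfying the Chevalley–Serre relations are the images of the generators under a
homomorphism. -/
theorem IsChevalley.exists_hom {e₁ e₂ f₁ f₂ h₁ h₂ : L} (H : IsChevalley e₁ e₂ f₁ f₂ h₁ h₂) :
    ∃ φ : Chevalley →ₗ⁅ℂ⁆ L, φ (e 0) = e₁ ∧ φ (e 1) = e₂ ∧ φ (f 0) = f₁ ∧ φ (f 1) = f₂ ∧
      φ (h 0) = h₁ ∧ φ (h 1) = h₂ := by
  let φ : FreeLieAlgebra ℂ (CartanMatrix.Generators (Fin 2)) →ₗ⁅ℂ⁆ L :=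
    FreeLieAlgebra.lift ℂ fun
      | .E i => ![e₁, e₂] i
      | .F i => ![f₁, f₂] i
      | .H i => ![h₁, h₂] i
  have hφ : ∀ r ∈ CartanMatrix.Relations.toSet ℂ cartan, φ r = 0 := by
    rw [map_relations_eq_zero_iff]
    simpa [φ] using H
  have hker : CartanMatrix.Relations.toIdeal ℂ cartan ≤ φ.ker := by
    rw [CartanMatrix.Relations.toIdeal, LieSubmodule.lieSpan_le]
    exact fun r hr => LieHom.mem_ker.mpr (hφ r hr)
  let q : Chevalley →ₗ[ℂ] L :=
    Submodule.liftQ (CartanMatrix.Relations.toIdeal ℂ cartan).toSubmodule (φ : _ →ₗ[ℂ] L)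
      fun x hx => LinearMap.mem_ker.mpr (LieHom.mem_ker.mp (hker hx))
  have hq (x) : q (proj x) = φ x := rfl
  refine ⟨{ q with map_lie' := ?_ }, ?_⟩
  · intro x y
    obtain ⟨x, rfl⟩ := proj_surjective x
    obtain ⟨y, rfl⟩ := proj_surjective y
    change q ⁅proj x, proj y⁆ = ⁅q (proj x), q (proj y)⁆
    rw [← LieHom.map_lie, hq, hq, hq, LieHom.map_lie]
  · have hg (x) : q (gen x) = φ (.of ℂ x) := rfl
    change q (gen _) = _ ∧ q (gen _) = _ ∧ q (gen _) = _ ∧ q (gen _) = _ ∧ q (gen _) = _ ∧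
      q (gen _) = _
    simp [hg, φ]

end Relations

theorem eq_top_of_mem (K : LieSubalgebra ℂ Chevalley) (he₁ : e 0 ∈ K) (he₂ : e 1 ∈ K)
    (hf₁ : f 0 ∈ K) (hf₂ : f 1 ∈ K) : K = ⊤ := by
  refine eq_top_of_gen_mem K ?_
  have hh₁ : h 0 ∈ K := isChevalley_gen.e₁_f₁ ▸ K.lie_mem he₁ hf₁
  have hh₂ : h 1 ∈ K := isChevalley_gen.e₂_f₂ ▸ K.lie_mem he₂ hf₂
  rintro (i | i | i) <;> fin_cases i <;> assumption

/-- The locus where two homomorphisms agree is a subalgebra, and here it contains a generating set.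
-/
theorem chevalley_hom_ext {L : Type*} [LieRing L] [LieAlgebra ℂ L] {φ ψ : Chevalley →ₗ⁅ℂ⁆ L}
    (he₁ : φ (e 0) = ψ (e 0)) (he₂ : φ (e 1) = ψ (e 1)) (hf₁ : φ (f 0) = ψ (f 0))
    (hf₂ : φ (f 1) = ψ (f 1)) : φ = ψ := by
  let K : LieSubalgebra ℂ Chevalley :=
    { LinearMap.eqLocus (φ : Chevalley →ₗ[ℂ] L) (ψ : Chevalley →ₗ[ℂ] L) with
      lie_mem' := fun {a b} (ha : φ a = ψ a) (hb : φ b = ψ b) => by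
        change φ ⁅a, b⁆ = ψ ⁅a, b⁆
        rw [LieHom.map_lie, LieHom.map_lie, ha, hb] }
  have hK : K = ⊤ := eq_top_of_mem K he₁ he₂ hf₁ hf₂
  ext x
  have : x ∈ K := hK ▸ LieSubalgebra.mem_top x
  exact this

/-! ### The Chevalley generators of the matrix realization -/

set_option maxHeartbeats 4000000 in
/-- The commutator of two matrices of the matrix realization in terms of their blocks. -/
theorem lie_blockMatrix_eq (v w φ ψ : Fin 3 → ℂ) (A A' : Matrix (Fin 3) (Fin 3) ℂ)
    (hA : A 0 0 + A 1 1 + A 2 2 = 0) (hA' : A' 0 0 + A' 1 1 + A' 2 2 = 0) :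
    ⁅blockMatrix v A φ, blockMatrix w A' ψ⁆ =
      blockMatrix (A *ᵥ w - A' *ᵥ v - rt2 • crossProduct φ ψ)
        (A * A' - A' * A + (3 / 2 : ℂ) • (vecMulVec v ψ - vecMulVec w φ) -
          ((v ⬝ᵥ ψ - w ⬝ᵥ φ) / 2) • 1)
        (φ ᵥ* A' - ψ ᵥ* A + rt2 • crossProduct v w) := by
  have hr : rt2⁻¹ ^ 2 = 1 / 2 := by rw [sq, rt2_inv_mul_self]
  -- With r = 1/√2 one has √2 = 2r and r² = 1/2, so every entry becomes a polynomial identity in r.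
  have hr2 : rt2 = 2 * rt2⁻¹ := by
    rw [eq_mul_inv_iff_mul_eq₀ rt2_ne_zero, rt2_mul_self]
  -- Vanishing trace is essential: AᵗB(v) + B(v)A + B(Av) = tr(A) B(v).
  have hA2 : A 2 2 = -A 0 0 - A 1 1 := by linear_combination hA
  have hA2' : A' 2 2 = -A' 0 0 - A' 1 1 := by linear_combination hA'
  -- In the upper left block B(φᵗ)B(w) = (φ·w)1 - wφ; half of this adds to the rank-one terms,
  -- whence the factor 3/2 and the scalar correction.
  rw [Ring.lie_def, ← Matrix.ext_iff]
  refine forall_fin_seven ⟨?_, ?_, ?_, ?_, ?_, ?_, ?_⟩ <;>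
  refine forall_fin_seven ⟨?_, ?_, ?_, ?_, ?_, ?_, ?_⟩ <;>
  simp only [Matrix.sub_apply, Matrix.mul_apply, Fin.sum_univ_seven, blockMatrix_entries,
    Matrix.add_apply, Matrix.smul_apply, Pi.add_apply, Pi.sub_apply, Pi.smul_apply, smul_eq_mul,
    Matrix.mulVec, Matrix.vecMul, dotProduct, vecMulVec_apply, Fin.sum_univ_three, cross_apply,
    Matrix.cons_val, Matrix.one_apply_eq, Matrix.one_apply, hA2, hA2', reduceIte, Fin.reduceEq] <;>
  generalize rt2⁻¹ = r at hr hr2 ⊢ <;>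
  generalize rt2 = s at hr2 ⊢ <;>
  subst hr2 <;>
  ring_nf <;>
  simp only [hr] <;>
  ring

theorem smul_blockMatrix (c : ℂ) (v φ : Fin 3 → ℂ) (A : Matrix (Fin 3) (Fin 3) ℂ) :
    c • blockMatrix v A φ = blockMatrix (c • v) (c • A) (c • φ) := by
  rw [← Matrix.ext_iff]
  refine forall_fin_seven ⟨?_, ?_, ?_, ?_, ?_, ?_, ?_⟩ <;>
  refine forall_fin_seven ⟨?_, ?_, ?_, ?_, ?_, ?_, ?_⟩ <;>
  simp only [blockMatrix_entries, Matrix.smul_apply, Pi.smul_apply, smul_eq_mul] <;> ring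

theorem add_blockMatrix (v w φ ψ : Fin 3 → ℂ) (A A' : Matrix (Fin 3) (Fin 3) ℂ) :
    blockMatrix v A φ + blockMatrix w A' ψ = blockMatrix (v + w) (A + A') (φ + ψ) := by
  rw [← Matrix.ext_iff]
  refine forall_fin_seven ⟨?_, ?_, ?_, ?_, ?_, ?_, ?_⟩ <;>
  refine forall_fin_seven ⟨?_, ?_, ?_, ?_, ?_, ?_, ?_⟩ <;>
  simp only [blockMatrix_entries, Matrix.add_apply, Pi.add_apply] <;> ring

theorem blockMatrix_zero : blockMatrix ![0, 0, 0] !![0, 0, 0; 0, 0, 0; 0, 0, 0] ![0, 0, 0] = 0 := by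
  rw [← Matrix.ext_iff]
  refine forall_fin_seven ⟨?_, ?_, ?_, ?_, ?_, ?_, ?_⟩ <;>
  refine forall_fin_seven ⟨?_, ?_, ?_, ?_, ?_, ?_, ?_⟩ <;>
  simp [blockMatrix_entries]

theorem blockMatrix_congr {v w φ ψ : Fin 3 → ℂ} {A A' : Matrix (Fin 3) (Fin 3) ℂ}
    (hv : ∀ i, v i = w i) (hA : ∀ i j, A i j = A' i j) (hφ : ∀ i, φ i = ψ i) :
    blockMatrix v A φ = blockMatrix w A' ψ := by
  rw [funext hv, Matrix.ext hA, funext hφ]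

/-- The image of `e₁` in the matrix realization. -/
def matE₁ : Matrix (Fin 7) (Fin 7) ℂ :=
  blockMatrix ![0, 0, 0] !![0, 1, 0; 0, 0, 0; 0, 0, 0] ![0, 0, 0]

/-- The image of `e₂` in the matrix realization. -/
def matE₂ : Matrix (Fin 7) (Fin 7) ℂ :=
  blockMatrix ![0, rt2, 0] !![0, 0, 0; 0, 0, 0; 0, 0, 0] ![0, 0, 0]

/-- The image of `f₁` in the matrix realization. -/
def matF₁ : Matrix (Fin 7) (Fin 7) ℂ :=
  blockMatrix ![0, 0, 0] !![0, 0, 0; 1, 0, 0; 0, 0, 0] ![0, 0, 0]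

/-- The image of `f₂` in the matrix realization. -/
def matF₂ : Matrix (Fin 7) (Fin 7) ℂ :=
  blockMatrix ![0, 0, 0] !![0, 0, 0; 0, 0, 0; 0, 0, 0] ![0, rt2, 0]

/-- The image of `h₁` in the matrix realization. -/
def matH₁ : Matrix (Fin 7) (Fin 7) ℂ :=
  blockMatrix ![0, 0, 0] !![1, 0, 0; 0, -1, 0; 0, 0, 0] ![0, 0, 0]

/-- The image of `h₂` in the matrix realization. -/
def matH₂ : Matrix (Fin 7) (Fin 7) ℂ :=
  blockMatrix ![0, 0, 0] !![-1, 0, 0; 0, 2, 0; 0, 0, -1] ![0, 0, 0]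

/-- The image of `⁅e₂, e₁⁆` in the matrix realization. -/
def matX₃ : Matrix (Fin 7) (Fin 7) ℂ :=
  blockMatrix ![-rt2, 0, 0] !![0, 0, 0; 0, 0, 0; 0, 0, 0] ![0, 0, 0]

/-- The image of `⁅e₂, ⁅e₂, e₁⁆⁆` in the matrix realization. -/
def matX₄ : Matrix (Fin 7) (Fin 7) ℂ :=
  blockMatrix ![0, 0, 0] !![0, 0, 0; 0, 0, 0; 0, 0, 0] ![0, 0, 2 * rt2]

/-- The image of `⁅e₂, ⁅e₂, ⁅e₂, e₁⁆⁆⁆` in the matrix realization. -/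
def matX₅ : Matrix (Fin 7) (Fin 7) ℂ :=
  blockMatrix ![0, 0, 0] !![0, 0, 0; 0, 0, 6; 0, 0, 0] ![0, 0, 0]

/-- The image of `⁅e₁, ⁅e₂, ⁅e₂, ⁅e₂, e₁⁆⁆⁆⁆` in the matrix realization. -/
def matX₆ : Matrix (Fin 7) (Fin 7) ℂ :=
  blockMatrix ![0, 0, 0] !![0, 0, 6; 0, 0, 0; 0, 0, 0] ![0, 0, 0]

/-- The image of `⁅f₂, f₁⁆` in the matrix realization. -/
def matY₃ : Matrix (Fin 7) (Fin 7) ℂ :=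
  blockMatrix ![0, 0, 0] !![0, 0, 0; 0, 0, 0; 0, 0, 0] ![rt2, 0, 0]

/-- The image of `⁅f₂, ⁅f₂, f₁⁆⁆` in the matrix realization. -/
def matY₄ : Matrix (Fin 7) (Fin 7) ℂ :=
  blockMatrix ![0, 0, 2 * rt2] !![0, 0, 0; 0, 0, 0; 0, 0, 0] ![0, 0, 0]

/-- The image of `⁅f₂, ⁅f₂, ⁅f₂, f₁⁆⁆⁆` in the matrix realization. -/
def matY₅ : Matrix (Fin 7) (Fin 7) ℂ :=
  blockMatrix ![0, 0, 0] !![0, 0, 0; 0, 0, 0; 0, -6, 0] ![0, 0, 0]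

/-- The image of `⁅f₁, ⁅f₂, ⁅f₂, ⁅f₂, f₁⁆⁆⁆⁆` in the matrix realization. -/
def matY₆ : Matrix (Fin 7) (Fin 7) ℂ :=
  blockMatrix ![0, 0, 0] !![0, 0, 0; 0, 0, 0; 6, 0, 0] ![0, 0, 0]

/-- Brackets of the Chevalley generators and root vectors of the matrix realization. -/
structure MatBrackets : Prop where
  e₁_f₁ : ⁅matE₁, matF₁⁆ = matH₁
  e₁_f₂ : ⁅matE₁, matF₂⁆ = 0
  e₂_f₁ : ⁅matE₂, matF₁⁆ = 0
  e₂_f₂ : ⁅matE₂, matF₂⁆ = matH₂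
  h₁_h₂ : ⁅matH₁, matH₂⁆ = 0
  h₁_e₁ : ⁅matH₁, matE₁⁆ = (2 : ℂ) • matE₁
  h₁_e₂ : ⁅matH₁, matE₂⁆ = (-1 : ℂ) • matE₂
  h₂_e₁ : ⁅matH₂, matE₁⁆ = (-3 : ℂ) • matE₁
  h₂_e₂ : ⁅matH₂, matE₂⁆ = (2 : ℂ) • matE₂
  h₁_f₁ : ⁅matH₁, matF₁⁆ = (-2 : ℂ) • matF₁
  h₁_f₂ : ⁅matH₁, matF₂⁆ = (1 : ℂ) • matF₂
  h₂_f₁ : ⁅matH₂, matF₁⁆ = (3 : ℂ) • matF₁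
  h₂_f₂ : ⁅matH₂, matF₂⁆ = (-2 : ℂ) • matF₂
  e₂_e₁ : ⁅matE₂, matE₁⁆ = matX₃
  e₂_x₃ : ⁅matE₂, matX₃⁆ = matX₄
  e₂_x₄ : ⁅matE₂, matX₄⁆ = matX₅
  e₁_x₅ : ⁅matE₁, matX₅⁆ = matX₆
  e₁_x₃ : ⁅matE₁, matX₃⁆ = 0
  e₂_x₅ : ⁅matE₂, matX₅⁆ = 0
  f₂_f₁ : ⁅matF₂, matF₁⁆ = matY₃
  f₂_y₃ : ⁅matF₂, matY₃⁆ = matY₄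
  f₂_y₄ : ⁅matF₂, matY₄⁆ = matY₅
  f₁_y₅ : ⁅matF₁, matY₅⁆ = matY₆
  f₁_y₃ : ⁅matF₁, matY₃⁆ = 0
  f₂_y₅ : ⁅matF₂, matY₅⁆ = 0

set_option maxHeartbeats 4000000 in
theorem matBrackets : MatBrackets := by
  have hr := rt2_mul_self
  constructor <;>
  simp only [matE₁, matE₂, matF₁, matF₂, matH₁, matH₂, matX₃, matX₄, matX₅, matX₆, matY₃, matY₄, matY₅, matY₆, ← blockMatrix_zero, smul_blockMatrix] <;>
  (rw [lie_blockMatrix_eq _ _ _ _ _ _ (by simp; try norm_num) (by simp; try norm_num)]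
   refine blockMatrix_congr ?_ ?_ ?_) <;>
  simp only [Fin.forall_fin_succ, Fin.succ_zero_eq_one, Fin.succ_one_eq_two, IsEmpty.forall_iff,
    and_true, Matrix.sub_apply, Matrix.mul_apply, Matrix.add_apply, Matrix.smul_apply,
    Pi.add_apply, Pi.sub_apply, Pi.smul_apply, smul_eq_mul, Matrix.mulVec, Matrix.vecMul,
    dotProduct, vecMulVec_apply, Fin.sum_univ_three, cross_apply, Matrix.cons_val,
    Matrix.of_apply, Matrix.one_apply, reduceIte, Fin.reduceEq, mul_zero, zero_mul, add_zero,
    zero_add, sub_zero, zero_sub, neg_zero, zero_div, true_and, and_self] <;>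
  grind

theorem isChevalley_mat : IsChevalley matE₁ matE₂ matF₁ matF₂ matH₁ matH₂ := by
  have H := matBrackets
  exact ⟨H.e₁_f₁, H.e₁_f₂, H.e₂_f₁, H.e₂_f₂, H.h₁_h₂, H.h₁_e₁, H.h₁_e₂, H.h₂_e₁, H.h₂_e₂, H.h₁_f₁,
    H.h₁_f₂, H.h₂_f₁, H.h₂_f₂, by rw [← lie_skew matE₁ matE₂, H.e₂_e₁, lie_neg, H.e₁_x₃, neg_zero],
    by rw [H.e₂_e₁, H.e₂_x₃, H.e₂_x₄, H.e₂_x₅],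
    by rw [← lie_skew matF₁ matF₂, H.f₂_f₁, lie_neg, H.f₁_y₃, neg_zero],
    by rw [H.f₂_f₁, H.f₂_y₃, H.f₂_y₄, H.f₂_y₅]⟩

/-- The span of the root vectors and coroots of the matrix realization, in terms of blocks. -/
theorem sum_smul_chevalleyBasis_mat (x y : Fin 6 → ℂ) (z : Fin 2 → ℂ) :
    ∑ k, Sum.elim x (Sum.elim y z) k • chevalleyBasis matE₁ matE₂ matF₁ matF₂ matH₁ matH₂ k =
      blockMatrix ![-(rt2 * x 2), rt2 * x 1, 2 * rt2 * y 3]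
        !![z 0 - z 1, x 0, 6 * x 5; y 0, 2 * z 1 - z 0, 6 * x 4; 6 * y 5, -(6 * y 4), -z 1]
        ![rt2 * y 2, rt2 * y 1, 2 * rt2 * x 3] := by
  have H := matBrackets
  have hx : rootVector matE₁ matE₂ = ![matE₁, matE₂, matX₃, matX₄, matX₅, matX₆] := by
    rw [rootVector, H.e₂_e₁, H.e₂_x₃, H.e₂_x₄, H.e₁_x₅]
  have hy : rootVector matF₁ matF₂ = ![matF₁, matF₂, matY₃, matY₄, matY₅, matY₆] := by
    rw [rootVector, H.f₂_f₁, H.f₂_y₃, H.f₂_y₄, H.f₁_y₅]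
  simp only [Fintype.sum_sum_type, Sum.elim_inl, Sum.elim_inr, chevalleyBasis, hx, hy,
    Fin.sum_univ_six, Fin.sum_univ_two, Matrix.cons_val]
  simp only [matE₁, matE₂, matF₁, matF₂, matH₁, matH₂, matX₃, matX₄, matX₅, matX₆, matY₃, matY₄, matY₅, matY₆, smul_blockMatrix, add_blockMatrix]
  refine blockMatrix_congr ?_ ?_ ?_ <;>
  simp only [Fin.forall_fin_succ, Fin.succ_zero_eq_one, Fin.succ_one_eq_two, IsEmpty.forall_iff,
    and_true, Matrix.add_apply, Matrix.smul_apply, Pi.add_apply, Pi.smul_apply, smul_eq_mul,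
    Matrix.cons_val, Matrix.of_apply] <;>
  grind

set_option maxHeartbeats 1000000 in
-- Off the diagonal, only one Xᵃ has a nonzero (j, i) entry in each case, so Gᵢⱼ is a single dual
-- vector. The factor √2 arises because the short root vectors have block entry √2, while G₂₄ and
-- G₄₂ have block entry 2.
theorem G_eq_mat : G 0 1 = (3 : ℂ) • matE₁ ∧ G 1 3 = rt2 • matE₂ ∧ G 1 0 = (3 : ℂ) • matF₁ ∧
    G 3 1 = rt2 • matF₂ ∧ G 0 0 - G 1 1 = (3 : ℂ) • matH₁ ∧ G 1 1 = matH₂ := by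
  have hr : rt2 * rt2⁻¹ = 1 := mul_inv_cancel₀ rt2_ne_zero
  have hr2 := rt2_mul_self
  have rev : (0 : Fin 7).rev = 6 ∧ (1 : Fin 7).rev = 5 ∧ (2 : Fin 7).rev = 4 ∧
      (3 : Fin 7).rev = 3 ∧ (4 : Fin 7).rev = 2 ∧ (5 : Fin 7).rev = 1 ∧ (6 : Fin 7).rev = 0 := by
    decide
  refine ⟨?_, ?_, ?_, ?_, ?_, ?_⟩ <;>
  simp [G, Fin.sum_univ_succ, basisX, dualX, F, rev, matE₁, matE₂, matF₁, matF₂,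
    matH₁, matH₂, smul_blockMatrix] <;>
  rw [← Matrix.ext_iff] <;>
  refine forall_fin_seven ⟨?_, ?_, ?_, ?_, ?_, ?_, ?_⟩ <;>
  refine forall_fin_seven ⟨?_, ?_, ?_, ?_, ?_, ?_, ?_⟩ <;>
  simp [blockMatrix_entries] <;>
  grind

/-! ### The isomorphism -/

section Hom

variable {L M : Type*} [LieRing L] [LieAlgebra ℂ L] [LieRing M] [LieAlgebra ℂ M]

theorem map_chevalleyBasis (φ : L →ₗ⁅ℂ⁆ M) (e₁ e₂ f₁ f₂ h₁ h₂ : L) (k : Fin 6 ⊕ Fin 6 ⊕ Fin 2) :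
    φ (chevalleyBasis e₁ e₂ f₁ f₂ h₁ h₂ k) =
      chevalleyBasis (φ e₁) (φ e₂) (φ f₁) (φ f₂) (φ h₁) (φ h₂) k := by
  rcases k with k | k | k <;> fin_cases k <;> simp [chevalleyBasis, rootVector]

end Hom

/-- The Chevalley presentation is isomorphic to the matrix realization. -/
theorem exists_chevalleyEquiv : ∃ Φ : Chevalley ≃ₗ⁅ℂ⁆ g,
    (Φ (e 0) : Matrix (Fin 7) (Fin 7) ℂ) = matE₁ ∧ (Φ (e 1) : Matrix (Fin 7) (Fin 7) ℂ) = matE₂ ∧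
    (Φ (f 0) : Matrix (Fin 7) (Fin 7) ℂ) = matF₁ ∧ (Φ (f 1) : Matrix (Fin 7) (Fin 7) ℂ) = matF₂ ∧
    (Φ (h 0) : Matrix (Fin 7) (Fin 7) ℂ) = matH₁ ∧
    (Φ (h 1) : Matrix (Fin 7) (Fin 7) ℂ) = matH₂ := by
  obtain ⟨φ, he₁, he₂, hf₁, hf₂, hh₁, hh₂⟩ := isChevalley_mat.exists_hom
  let b := chevalleyBasis (e 0) (e 1) (f 0) (f 1) (h 0) (h 1)
  have hb (c : Fin 6 ⊕ Fin 6 ⊕ Fin 2 → ℂ) : φ (∑ k, c k • b k) =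
      ∑ k, c k • chevalleyBasis matE₁ matE₂ matF₁ matF₂ matH₁ matH₂ k := by
    simp only [map_sum, map_smul, b, map_chevalleyBasis, he₁, he₂, hf₁, hf₂, hh₁, hh₂]
  have hspan (x : Chevalley) : ∃ (c d : Fin 6 → ℂ) (z : Fin 2 → ℂ),
      ∑ k, Sum.elim c (Sum.elim d z) k • b k = x := by
    have hx : x ∈ Submodule.span ℂ (Set.range b) :=
      isChevalley_gen.span_eq_top eq_top_of_mem ▸ Submodule.mem_top
    obtain ⟨c, rfl⟩ := (Submodule.mem_span_range_iff_exists_fun ℂ).mp hx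
    refine ⟨c ∘ .inl, c ∘ .inr ∘ .inl, c ∘ .inr ∘ .inr, Finset.sum_congr rfl ?_⟩
    rintro (k | k | k) - <;> rfl
  have hinj : Function.Injective φ := by
    rw [injective_iff_map_eq_zero]
    intro x hx
    obtain ⟨c, d, z, rfl⟩ := hspan x
    rw [hb, sum_smul_chevalleyBasis_mat] at hx
    have E (i j : Fin 7) := congrFun (congrFun hx i) j
    have hr := rt2_ne_zero
    -- Each root coefficient is, up to a nonzero factor, one entry of A, v or φ; the last diagonal
    -- entry of A gives `z 1`, and then the first gives `z 0`.
    have E00 := E 0 0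
    have E01 := E 0 1
    have E02 := E 0 2
    have E10 := E 1 0
    have E12 := E 1 2
    have E20 := E 2 0
    have E21 := E 2 1
    have E22 := E 2 2
    have E03 := E 0 3
    have E13 := E 1 3
    have E23 := E 2 3
    have E30 := E 3 0
    have E31 := E 3 1
    have E32 := E 3 2
    simp only [blockMatrix_entries, Matrix.of_apply, Matrix.cons_val, Matrix.zero_apply,
      neg_eq_zero, mul_eq_zero, hr, false_or, OfNat.ofNat_ne_zero] at *
    rw [E22, sub_zero] at E00
    refine Finset.sum_eq_zero ?_
    rintro (k | k | k) - <;> fin_cases k <;> simp [*]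
  -- So far `φ` takes values in all 7 × 7 matrices; its image is now identified with `g`.
  have hrange : (φ.range : Set (Matrix (Fin 7) (Fin 7) ℂ)) = g := by
    ext M
    constructor
    · rintro ⟨x, rfl⟩
      obtain ⟨c, d, z, rfl⟩ := hspan x
      change φ _ ∈ LinearMap.range rep
      rw [hb, sum_smul_chevalleyBasis_mat]
      refine blockMatrix_mem _ _ _ ?_
      simp only [Matrix.of_apply, Matrix.cons_val]
      ring
    · rintro ⟨⟨v, ⟨A, hA⟩, ψ⟩, rfl⟩
      replace hA : Matrix.trace A = 0 := hA
      rw [Matrix.trace_fin_three] at hA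
      -- The coefficients solve the block formula of `sum_smul_chevalleyBasis_mat` entry by entry.
      -- The middle diagonal entry 2z₁ - z₀ (indices from 0) comes out as -A₀₀ - A₂₂, which is A₁₁
      -- because the trace is zero.
      refine ⟨∑ k, Sum.elim
        ![A 0 1, rt2⁻¹ * v 1, -(rt2⁻¹ * v 0), rt2⁻¹ * ψ 2 / 2, A 1 2 / 6, A 0 2 / 6]
        (Sum.elim ![A 1 0, rt2⁻¹ * ψ 1, rt2⁻¹ * ψ 0, rt2⁻¹ * v 2 / 2, -(A 2 1 / 6), A 2 0 / 6]
          ![A 0 0 - A 2 2, -A 2 2]) k • b k, ?_⟩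
      change φ _ = blockMatrix v A ψ
      have hr : rt2 * rt2⁻¹ = 1 := mul_inv_cancel₀ rt2_ne_zero
      rw [hb, sum_smul_chevalleyBasis_mat]
      refine blockMatrix_congr ?_ ?_ ?_ <;>
      simp only [Fin.forall_fin_succ, Fin.succ_zero_eq_one, Fin.succ_one_eq_two,
        IsEmpty.forall_iff, and_true, Matrix.cons_val, Matrix.of_apply] <;>
      grind
  refine ⟨(LieEquiv.ofInjective φ hinj).trans (LieEquiv.ofEq _ _ hrange), ?_⟩
  exact ⟨he₁, he₂, hf₁, hf₂, hh₁, hh₂⟩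

end GTwo

end

theorem mainTheorem7 :
    ∃ Φ : GTwo.Chevalley ≃ₗ⁅ℂ⁆ GTwo.g,
      ((Φ (GTwo.e 0) : Matrix (Fin 7) (Fin 7) ℂ) = (1 / 3 : ℂ) • GTwo.G 0 1 ∧
        (Φ (GTwo.e 1) : Matrix (Fin 7) (Fin 7) ℂ) = (1 / GTwo.rt2) • GTwo.G 1 3 ∧
        (Φ (GTwo.f 0) : Matrix (Fin 7) (Fin 7) ℂ) = (1 / 3 : ℂ) • GTwo.G 1 0 ∧
        (Φ (GTwo.f 1) : Matrix (Fin 7) (Fin 7) ℂ) = (1 / GTwo.rt2) • GTwo.G 3 1) ∧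
      (∀ Ψ : GTwo.Chevalley →ₗ⁅ℂ⁆ GTwo.g,
        ((Ψ (GTwo.e 0) : Matrix (Fin 7) (Fin 7) ℂ) = (1 / 3 : ℂ) • GTwo.G 0 1 ∧
          (Ψ (GTwo.e 1) : Matrix (Fin 7) (Fin 7) ℂ) = (1 / GTwo.rt2) • GTwo.G 1 3 ∧
          (Ψ (GTwo.f 0) : Matrix (Fin 7) (Fin 7) ℂ) = (1 / 3 : ℂ) • GTwo.G 1 0 ∧
          (Ψ (GTwo.f 1) : Matrix (Fin 7) (Fin 7) ℂ) = (1 / GTwo.rt2) • GTwo.G 3 1) →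
        Ψ = Φ.toLieHom) ∧
      (Φ (GTwo.h 0) : Matrix (Fin 7) (Fin 7) ℂ) = (1 / 3 : ℂ) • (GTwo.G 0 0 - GTwo.G 1 1) ∧
      (Φ (GTwo.h 1) : Matrix (Fin 7) (Fin 7) ℂ) = GTwo.G 1 1 := by
  obtain ⟨Φ, he₁, he₂, hf₁, hf₂, hh₁, hh₂⟩ := GTwo.exists_chevalleyEquiv
  obtain ⟨g₀₁, g₁₃, g₁₀, g₃₁, g₀₀, g₁₁⟩ := GTwo.G_eq_mat
  have third (M : Matrix (Fin 7) (Fin 7) ℂ) : (1 / 3 : ℂ) • (3 : ℂ) • M = M := by module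
  have root (M : Matrix (Fin 7) (Fin 7) ℂ) : (1 / GTwo.rt2) • GTwo.rt2 • M = M := by
    rw [smul_smul, one_div_mul_cancel GTwo.rt2_ne_zero, one_smul]
  rw [g₀₀, g₀₁, g₁₃, g₁₀, g₃₁, g₁₁, third, third, third, root, root]
  refine ⟨Φ, ⟨he₁, he₂, hf₁, hf₂⟩, ?_, hh₁, hh₂⟩
  rintro Ψ ⟨ke₁, ke₂, kf₁, kf₂⟩
  exact GTwo.chevalley_hom_ext (Subtype.ext (ke₁.trans he₁.symm)) (Subtype.ext (ke₂.trans he₂.symm))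
    (Subtype.ext (kf₁.trans hf₁.symm)) (Subtype.ext (kf₂.trans hf₂.symm))
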